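/- A bornology on a set is a cover of it that is closed under passing to subsets and under finite unions; its members are called bounded. A large scale group is a group $G$ with a bornology $\mathcal B$ such that $A\cdot B\in\mathcal B$ and $A^{-1}\in\mathcal B$ for all $A,B\in\mathcal B$. For a subset $A$ and a family $\mathcal U$ of subsets of a set, let $\mathrm{st}(A,\mathcal U)$ be the union of those $U\in\mathcal U$ that meet $A$. A large scale space is a set $X$ with a non-empty collection of covers of $X$, called uniformly bounded, such that $\{\mathrm{st}(A,\mathcal V)\}_{A\in\mathcal U}$ is uniformly bounded whenever $\mathcal U$ and $\mathcal V$ are, every cover refining a uniformly bounded cover is uniformly bounded, and the union of two bounded sets is bounded, where a set is bounded if it is contained in an element of a uniformly bounded cover. A large scale group $G$ is a large scale space whose uniformly bounded covers are the covers that refine $\{g\cdot B\}_{g\in G}$ for some $B\in\mathcal B$; its bounded sets are the members of $\mathcal B$. A subset $A$ of a large scale space $X$ is coarsely clopen if $\mathrm{st}(A,\mathcal U)\cap\mathrm{st}(X\setminus A,\mathcal U)$ is bounded for every uniformly bounded cover $\mathcal U$. An end of $X$ is a family of unbounded coarsely clopen subsets of $X$ that is maximal with respect to the property that all finite intersections of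 its members (including the empty intersection $X$) are unbounded. A map $f:X\to Y$ of large scale spaces is coarse if preimages of bounded sets are bounded, and large scale continuous if for each uniformly bounded cover $\mathcal U$ of $X$ the family $\{f(U)\}_{U\in\mathcal U}$ refines a uniformly bounded cover of $Y$. Spaces $X$ and $Y$ are coarsely equivalent if there are coarse, large scale continuous maps $f:X\to Y$ and $g:Y\to X$ and uniformly bounded covers $\mathcal U$ of $X$ and $\mathcal V$ of $Y$ such that $g(f(x))\in\mathrm{st}(\{x\},\mathcal U)$ for all $x\in X$ and $f(g(y))\in\mathrm{st}(\{y\},\mathcal V)$ for all $y\in Y$. A large scale space has bounded geometry if it is coarsely equivalent to a large scale space $Y$ such that for each uniformly bounded cover $\mathcal U$ of $Y$ there is $N\in\mathbb N$ such that every element of $\mathcal U$ has at most $N$ elements. **Theorem 9.13.** Let $G$ be a large scale group of bounded geometry that has exactly two ends. Suppose that $G$ is $\sigma$-bounded, i.e. a countable union of bounded subsets, and that $G$ is not locally bounded, i.e. there is a bounded subset $B$ of $G$ such that the subgroup $\langle B\rangle$ is unbounded. Then $G$ contains an infinite cyclic subgroup $H$ of bounded index, i.e. such that $B\cdot H=G$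 for some bounded subset $B$ of $G$. -/

import Mathlib

open scoped Pointwise

universe u v

/-! ## Large scale spaces -/

/-- The star of `A` with respect to the family `𝒰`: the union of all `W ∈ 𝒰` that meet `A`. -/
def starSet {X : Type u} (A : Set X) (𝒰 : Set (Set X)) : Set X :=
  {x | ∃ W ∈ 𝒰, (A ∩ W).Nonempty ∧ x ∈ W}

/-- The family of the stars `st(A, 𝒱)` with `A ∈ 𝒰`. -/
def starFamily {X : Type u} (𝒰 𝒱 : Set (Set X)) : Set (Set X) :=
  (fun A => starSet A 𝒱) '' 𝒰

/-- `𝒱` is a refinement of `𝒰`. -/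
def Refines {X : Type u} (𝒱 𝒰 : Set (Set X)) : Prop :=
  ∀ V ∈ 𝒱, ∃ W ∈ 𝒰, V ⊆ W

/-- A large scale structure on `X`, given by its uniformly bounded covers. Large scale spaces are
assumed to be coarsely connected: the union of two bounded sets (sets contained in an element of a
uniformly bounded cover) is bounded. -/
structure LargeScaleStructure (X : Type u) where
  covers : Set (Set (Set X))
  covers_nonempty : covers.Nonempty
  sUnion_eq_univ : ∀ 𝒰 ∈ covers, ⋃₀ 𝒰 = Set.univ
  star_mem : ∀ 𝒰 ∈ covers, ∀ 𝒱 ∈ covers, starFamily 𝒰 𝒱 ∈ covers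
  mem_of_refines : ∀ 𝒰 ∈ covers, ∀ 𝒱 : Set (Set X), ⋃₀ 𝒱 = Set.univ → Refines 𝒱 𝒰 → 𝒱 ∈ covers
  coarsely_connected : ∀ A C : Set X,
    (∃ 𝒰 ∈ covers, ∃ W ∈ 𝒰, A ⊆ W) → (∃ 𝒰 ∈ covers, ∃ W ∈ 𝒰, C ⊆ W) →
      ∃ 𝒰 ∈ covers, ∃ W ∈ 𝒰, A ∪ C ⊆ W

namespace LargeScaleStructure

variable {X : Type u} {Y : Type v}

/-- A set is bounded if it is contained in an element of a uniformly bounded cover. -/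
def Bdd (S : LargeScaleStructure X) (A : Set X) : Prop :=
  ∃ 𝒰 ∈ S.covers, ∃ W ∈ 𝒰, A ⊆ W

def CoarselyDisjoint (S : LargeScaleStructure X) (A C : Set X) : Prop :=
  ∀ 𝒰 ∈ S.covers, S.Bdd (starSet A 𝒰 ∩ starSet C 𝒰)

def CoarselyClopen (S : LargeScaleStructure X) (A : Set X) : Prop :=
  S.CoarselyDisjoint A Aᶜ

/-- A family of unbounded coarsely clopen sets all of whose finite intersections are unbounded.
The empty intersection, the whole space, is included. -/
def IsPreEnd (S : LargeScaleStructure X) (E : Set (Set X)) : Prop :=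
  (∀ A ∈ E, ¬ S.Bdd A ∧ S.CoarselyClopen A) ∧
    ∀ F : Set (Set X), F ⊆ E → F.Finite → ¬ S.Bdd (⋂₀ F)

/-- The set of ends: the maximal families of unbounded coarsely clopen sets all of whose finite
intersections are unbounded. -/
def ends (S : LargeScaleStructure X) : Set (Set (Set X)) :=
  {E | Maximal S.IsPreEnd E}

/-- `f x ∈ st(g x, 𝒰)` for all `x`, for one uniformly bounded cover `𝒰` of the target. -/
def Close (T : LargeScaleStructure Y) (f g : X → Y) : Prop :=
  ∃ 𝒰 ∈ T.covers, ∀ x, f x ∈ starSet {g x} 𝒰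

/-- Preimages of bounded sets are bounded. -/
def IsCoarse (S : LargeScaleStructure X) (T : LargeScaleStructure Y) (f : X → Y) : Prop :=
  ∀ K : Set Y, T.Bdd K → S.Bdd (f ⁻¹' K)

/-- The image of a uniformly bounded cover of the source is uniformly bounded in the target, that
is, it refines a uniformly bounded cover of the target. -/
def IsLargeScaleContinuous (S : LargeScaleStructure X) (T : LargeScaleStructure Y)
    (f : X → Y) : Prop :=
  ∀ 𝒰 ∈ S.covers, ∃ 𝒱 ∈ T.covers, Refines ((fun A => f '' A) '' 𝒰) 𝒱

/-- There are coarse, large scale continuous maps in both directions whose composites are close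
to the identities. -/
def CoarselyEquivalent (S : LargeScaleStructure X) (T : LargeScaleStructure Y) : Prop :=
  ∃ (f : X → Y) (g : Y → X),
    S.IsCoarse T f ∧ S.IsLargeScaleContinuous T f ∧
    T.IsCoarse S g ∧ T.IsLargeScaleContinuous S g ∧
    S.Close (g ∘ f) id ∧ T.Close (f ∘ g) id

/-- A large scale space has bounded geometry if it is coarsely equivalent to a large scale space
in which the elements of each uniformly bounded cover have uniformly bounded finite cardinality.
Taking `Y` in the universe of `X` loses nothing, since `Y` can be replaced by the image in it of
a coarse equivalence from `X`. -/
def BoundedGeometry (S : LargeScaleStructure X) : Prop :=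
  ∃ (Y : Type u) (T : LargeScaleStructure Y), S.CoarselyEquivalent T ∧
    ∀ 𝒰 ∈ T.covers, ∃ N : ℕ, ∀ A ∈ 𝒰, A.encard ≤ N

end LargeScaleStructure

/-! ## Large scale groups -/

/-- A large scale group is a group with a bornology that is stable under products and inverses;
these are the bornologies that arise as the bounded sets of a large scale structure whose uniformly
bounded covers are the covers that refine some `{g • B}_{g ∈ G}` with `B` in the bornology. -/
class LargeScaleGroup (G : Type u) [Group G] [Bornology G] : Prop where
  isBounded_mul : ∀ A B : Set G,
    Bornology.IsBounded A → Bornology.IsBounded B → Bornology.IsBounded (A * B)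
  isBounded_inv : ∀ A : Set G, Bornology.IsBounded A → Bornology.IsBounded A⁻¹

namespace LargeScaleGroup

variable (G : Type u) [Group G] [Bornology G]

/-- The family `{g • B}_{g ∈ G}`. -/
def translates {G : Type u} [Group G] (B : Set G) : Set (Set G) :=
  Set.range (fun g : G => g • B)

/-- The uniformly bounded covers: the covers that refine `{g • B}_{g ∈ G}` for a bounded `B`. -/
def uniformlyBoundedCovers : Set (Set (Set G)) :=
  {𝒰 | ⋃₀ 𝒰 = Set.univ ∧ ∃ B : Set G, Bornology.IsBounded B ∧ Refines 𝒰 (translates B)}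

variable {G} in
theorem translates_mem {B : Set G} (hB : Bornology.IsBounded B) (hne : B.Nonempty) :
    translates B ∈ uniformlyBoundedCovers G := by
  refine ⟨?_, B, hB, fun V hV => ⟨V, hV, subset_rfl⟩⟩
  obtain ⟨b, hb⟩ := hne
  refine Set.eq_univ_of_forall fun x => ⟨_, ⟨x * b⁻¹, rfl⟩, ?_⟩
  exact ⟨b, hb, by simp⟩

variable [LargeScaleGroup G]

variable {G} in
theorem exists_mem_cover_iff (A : Set G) :
    (∃ 𝒰 ∈ uniformlyBoundedCovers G, ∃ W ∈ 𝒰, A ⊆ W) ↔ Bornology.IsBounded A := by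
  constructor
  · rintro ⟨𝒰, ⟨-, B, hB, href⟩, W, hW, hAW⟩
    obtain ⟨_, ⟨g, rfl⟩, hWB⟩ := href W hW
    have h : Bornology.IsBounded (({g} : Set G) * B) :=
      isBounded_mul _ _ Bornology.isBounded_singleton hB
    refine h.subset (hAW.trans (hWB.trans ?_))
    rw [Set.singleton_mul]
    exact subset_rfl
  · intro hA
    refine ⟨_, translates_mem (B := A ∪ {1}) (hA.union Bornology.isBounded_singleton)
      ⟨1, by simp⟩, A ∪ {1}, ⟨1, by simp⟩, Set.subset_union_left⟩

/-- The large scale structure of a large scale group. -/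
def largeScale : LargeScaleStructure G where
  covers := uniformlyBoundedCovers G
  covers_nonempty := ⟨_, translates_mem (B := {1}) Bornology.isBounded_singleton ⟨1, rfl⟩⟩
  sUnion_eq_univ := fun 𝒰 h => h.1
  star_mem := by
    rintro 𝒰 ⟨hU, B, hB, hUB⟩ 𝒱 ⟨hV, C, hC, hVC⟩
    refine ⟨?_, B * C⁻¹ * C,
      isBounded_mul _ _ (isBounded_mul _ _ hB (isBounded_inv _ hC)) hC, ?_⟩
    · refine Set.eq_univ_of_forall fun x => ?_
      obtain ⟨A, hA, hxA⟩ : x ∈ ⋃₀ 𝒰 := hU ▸ Set.mem_univ x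
      obtain ⟨W, hW, hxW⟩ : x ∈ ⋃₀ 𝒱 := hV ▸ Set.mem_univ x
      exact ⟨_, ⟨A, hA, rfl⟩, W, hW, ⟨x, hxA, hxW⟩, hxW⟩
    · rintro _ ⟨A, hA, rfl⟩
      obtain ⟨_, ⟨g, rfl⟩, hAg⟩ := hUB A hA
      refine ⟨_, ⟨g, rfl⟩, ?_⟩
      rintro x ⟨W, hW, ⟨y, hyA, hyW⟩, hxW⟩
      obtain ⟨_, ⟨k, rfl⟩, hWk⟩ := hVC W hW
      obtain ⟨b, hb, hbe⟩ := hAg hyA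
      obtain ⟨c, hc, hce⟩ := hWk hyW
      obtain ⟨d, hd, hde⟩ := hWk hxW
      refine ⟨b * c⁻¹ * d, Set.mul_mem_mul (Set.mul_mem_mul hb (Set.inv_mem_inv.2 hc)) hd, ?_⟩
      simp only [smul_eq_mul] at hbe hce hde ⊢
      rw [← hde, ← mul_assoc, ← mul_assoc, hbe, ← hce]
      group
  mem_of_refines := by
    rintro 𝒰 ⟨-, B, hB, hUB⟩ 𝒱 hV hVU
    refine ⟨hV, B, hB, fun V hV' => ?_⟩
    obtain ⟨W, hW, hVW⟩ := hVU V hV'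
    obtain ⟨Z, hZ, hWZ⟩ := hUB W hW
    exact ⟨Z, hZ, hVW.trans hWZ⟩
  coarsely_connected := by
    intro A C hA hC
    rw [exists_mem_cover_iff] at *
    exact hA.union hC

/-- The bounded sets of the large scale structure are the members of the bornology. -/
theorem bdd_iff (A : Set G) : (largeScale G).Bdd A ↔ Bornology.IsBounded A :=
  exists_mem_cover_iff A

/-- Every bounded set generates a bounded subgroup. -/
def IsLocallyBounded (G : Type u) [Group G] [Bornology G] : Prop :=
  ∀ B : Set G, Bornology.IsBounded B → Bornology.IsBounded (Subgroup.closure B : Set G)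

/-- The group is a countable union of bounded sets. -/
def IsSigmaBounded (G : Type u) [Group G] [Bornology G] : Prop :=
  ∃ B : ℕ → Set G, (∀ n, Bornology.IsBounded (B n)) ∧ ⋃ n, B n = Set.univ

/-- `B * H = G` for some bounded set `B`. -/
def IsOfBoundedIndex {G : Type u} [Group G] [Bornology G] (H : Subgroup G) : Prop :=
  ∃ B : Set G, Bornology.IsBounded B ∧ B * (H : Set G) = Set.univ

end LargeScaleGroup

/-! Two ends give a coarsely clopen `A` with `A` and `Aᶜ` unbounded, and each translate `g • A`
agrees with `A` or with `Aᶜ` up to a bounded set (`isBounded_symmDiff_smul`). By bounded geometry,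
finitely many left translates of one bounded set `K` cover any given bounded set. As `G` is not
locally bounded, `A` then splits the subgroup `H` generated by some bounded `B` into two unbounded
parts (`exists_split_closure`).

Any two points of `H` are joined by steps in `B`, and a path from `A` to `Aᶜ` meets the boundary of
`A`, whose part in `H` lies in a ball `Q = B ^ n`. Take `g ∈ H ∩ A` that keeps `A` up to a bounded
set and moves `Q` off itself; it exists by `not_isBounded_stabilizer`. Connectedness forces `g` to
push `A ∩ H` into `A` (`translate_mem`), so the positive powers of `g` lie in `A` and outside `Q`,
and the negative ones lie outside `A`. By pigeonhole the powers are unbounded. For any `x`, the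
orbit `g ^ k * x` stays close to the powers `g ^ k`, hence cannot remain on one side of `A`. It
therefore meets the bounded set `symmDiff A (g • A)`, which yields bounded index
(`isOfBoundedIndex_zpowers`). -/

open Bornology LargeScaleGroup

/-! ### Coarse boundaries and paths with steps in a symmetric set -/

section Boundary

variable {G : Type u} [Group G]

/-- A set that is stable under right multiplication by a symmetric set is stable under right
multiplication by the subgroup that it generates. -/
theorem mul_mem_of_mem_closure {B S : Set G} (hsym : B⁻¹ = B)
    (hS : ∀ y ∈ S, ∀ b ∈ B, y * b ∈ S) {x h : G} (hx : x ∈ S) (hh : h ∈ Subgroup.closure B) :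
    x * h ∈ S := by
  induction hh using Subgroup.closure_induction_right with
  | one => simpa
  | mul_right a _ b hb ha => rw [← mul_assoc]; exact hS _ ha b hb
  | mul_inv_cancel a _ b hb ha =>
    rw [← mul_assoc]
    exact hS _ ha _ (by rw [← hsym]; simpa using hb)

theorem exists_mem_pow_of_mem_closure {B : Set G} (hsym : B⁻¹ = B) {h : G}
    (hh : h ∈ Subgroup.closure B) : ∃ n : ℕ, h ∈ B ^ n := by
  have := mul_mem_of_mem_closure (S := {x | ∃ n : ℕ, x ∈ B ^ n}) hsym
    (fun y ⟨n, hn⟩ b hb => ⟨n + 1, by rw [pow_succ]; exact Set.mul_mem_mul hn hb⟩)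
    (x := 1) ⟨0, by simp⟩ hh
  simpa using this

/-- The points at scale `B` from both `A` and its complement. -/
def coarseBoundary (A B : Set G) : Set G := A * B ∩ (Aᶜ * B)

theorem coarseBoundary_compl (A B : Set G) : coarseBoundary Aᶜ B = coarseBoundary A B := by
  rw [coarseBoundary, coarseBoundary, compl_compl, Set.inter_comm]

/-- Each endpoint of a step that changes sides is reached from itself by `1` and from the other
endpoint by `b` or `b⁻¹`. -/
theorem mem_coarseBoundary {A B : Set G} (h1 : 1 ∈ B) (hsym : B⁻¹ = B) {y b : G} (hb : b ∈ B)
    (h : ¬ (y ∈ A ↔ y * b ∈ A)) : y ∈ coarseBoundary A B ∧ y * b ∈ coarseBoundary A B := by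
  have hb' : b⁻¹ ∈ B := by rw [← hsym]; simpa using hb
  by_cases hy : y ∈ A
  · have hyb : y * b ∉ A := fun h' => h ⟨fun _ => h', fun _ => hy⟩
    exact ⟨⟨⟨y, hy, 1, h1, by simp⟩, ⟨y * b, hyb, b⁻¹, hb', by simp⟩⟩,
      ⟨⟨y, hy, b, hb, rfl⟩, ⟨y * b, hyb, 1, h1, by simp⟩⟩⟩
  · have hyb : y * b ∈ A := by tauto
    exact ⟨⟨⟨y * b, hyb, b⁻¹, hb', by simp⟩, ⟨y, hy, 1, h1, by simp⟩⟩,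
      ⟨⟨y * b, hyb, 1, h1, by simp⟩, ⟨y, hy, b, hb, rfl⟩⟩⟩

/-- A left coset of the subgroup generated by `B` that is divided by `A` meets the boundary. -/
theorem exists_mem_coarseBoundary {A B : Set G} (h1 : 1 ∈ B) (hsym : B⁻¹ = B) {x h : G}
    (hh : h ∈ Subgroup.closure B) (hx : x ∈ A) (hxh : x * h ∉ A) :
    ∃ k ∈ Subgroup.closure B, x * k ∈ coarseBoundary A B := by
  by_contra! hk
  refine hxh (mul_mem_of_mem_closure (S := {y | y ∈ A ∧ x⁻¹ * y ∈ Subgroup.closure B}) hsym ?_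
    ⟨hx, by simp⟩ hh).1
  rintro y ⟨hy, hyc⟩ b hb
  refine ⟨?_, by rw [← mul_assoc]; exact mul_mem hyc (Subgroup.subset_closure hb)⟩
  by_contra hyb
  refine hk _ hyc ?_
  rw [mul_inv_cancel_left]
  exact (mem_coarseBoundary h1 hsym hb (by tauto)).1

/-- Translates of `B ^ n` that miss the boundary are not divided by `A`. -/
theorem mem_iff_of_forall_notMem_coarseBoundary {A B : Set G} (h1 : 1 ∈ B) (hsym : B⁻¹ = B)
    {g : G} {n : ℕ} (hg : ∀ q ∈ B ^ n, g * q ∉ coarseBoundary A B) :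
    ∀ q ∈ B ^ n, (g * q ∈ A ↔ g ∈ A) := by
  have key : ∀ k ≤ n, ∀ q ∈ B ^ k, (g * q ∈ A ↔ g ∈ A) := by
    intro k
    induction k with
    | zero => simp
    | succ k ih =>
      intro hk q hq
      rw [pow_succ] at hq
      obtain ⟨y, hy, b, hb, rfl⟩ := hq
      rw [← ih (by omega) y hy, ← mul_assoc]
      by_contra hne
      exact hg y (Set.pow_subset_pow_right h1 (by omega) hy)
        (mem_coarseBoundary h1 hsym hb fun h => hne h.symm).1
  exact key n le_rfl

/-- If a translate `g * B ^ n` of a ball that contains the boundary of `A` lies in `A` and is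
disjoint from the ball, then left multiplication by `g` moves `A` into itself, unless it moves
`A` over the complement. -/
theorem translate_mem {A B : Set G} (h1 : 1 ∈ B) (hsym : B⁻¹ = B) {g : G} {n : ℕ}
    (hgH : g ∈ Subgroup.closure B) (hgA : g ∈ A)
    (hQ : ∀ x ∈ Subgroup.closure B, x ∈ coarseBoundary A B → x ∈ B ^ n)
    (hdisj : ∀ q ∈ B ^ n, g * q ∉ B ^ n)
    (hun : ∃ y ∈ Subgroup.closure B, y ∉ A ∧ g⁻¹ * y ∉ A) :
    (∀ q ∈ B ^ n, g * q ∈ A) ∧ (∀ q ∈ B ^ n, g⁻¹ * q ∉ A) ∧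
      ∀ x ∈ Subgroup.closure B, x ∉ A → g⁻¹ * x ∉ A := by
  have hQH : ∀ q ∈ B ^ n, q ∈ Subgroup.closure B := by
    intro q hq
    exact Submonoid.pow_subset Subgroup.subset_closure hq
  have hdisj' : ∀ q ∈ B ^ n, g⁻¹ * q ∉ B ^ n := fun q hq hq' => hdisj _ hq' (by simpa using hq)
  have hgQ := mem_iff_of_forall_notMem_coarseBoundary h1 hsym (A := A) (g := g) (n := n)
    fun q hq hb => hdisj q hq (hQ _ (mul_mem hgH (hQH q hq)) hb)
  have hgQ' := mem_iff_of_forall_notMem_coarseBoundary h1 hsym (A := A) (g := g⁻¹) (n := n)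
    fun q hq hb => hdisj' q hq (hQ _ (mul_mem (inv_mem hgH) (hQH q hq)) hb)
  have hiff : ∀ z ∈ Subgroup.closure B, z ∉ A → (g⁻¹ * z ∈ A ↔ g⁻¹ ∈ A) := by
    intro z hz hzA
    by_contra hne
    -- Walk inside `H` from a counterexample `z` to `1`, which is not one. No step can leave the set
    -- of counterexamples: if `w` crosses into `A`, then `w` lies in the ball, where `g⁻¹ * w` is on
    -- the side of `g⁻¹`; if `g⁻¹ * w` changes sides, then `g⁻¹ * w` lies in the ball, so `w` lies
    -- in its `g`-translate, which is inside `A`.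
    have := mul_mem_of_mem_closure (x := z) (h := z⁻¹)
      (S := {w | w ∈ Subgroup.closure B ∧ w ∉ A ∧ ¬ (g⁻¹ * w ∈ A ↔ g⁻¹ ∈ A)}) hsym
      (by
        rintro w ⟨hw, hwA, hwne⟩ b hb
        refine ⟨mul_mem hw (Subgroup.subset_closure hb), fun hwb => hwne (hgQ' w (hQ w hw
          (mem_coarseBoundary h1 hsym hb (by tauto)).1)), fun hwb => hwne ?_⟩
        rw [← hwb]
        by_contra hcross
        rw [← mul_assoc] at hcross
        have h' := hQ _ (mul_mem (inv_mem hgH) hw) (mem_coarseBoundary h1 hsym hb hcross).1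
        have h'' := (hgQ _ h').2 hgA
        rw [mul_inv_cancel_left] at h''
        exact hwA h'')
      ⟨hz, hzA, hne⟩ (inv_mem hz)
    simp at this
  obtain ⟨y, hy, hyA, hgy⟩ := hun
  have hg' : g⁻¹ ∉ A := fun h => hgy ((hiff y hy hyA).2 h)
  exact ⟨fun q hq => (hgQ q hq).2 hgA, fun q hq h => hg' ((hgQ' q hq).1 h),
    fun x hx hxA h => hg' ((hiff x hx hxA).1 h)⟩

end Boundary

/-! ### Coarsely clopen sets and ends -/

namespace LargeScaleStructure

variable {X : Type u} (S : LargeScaleStructure X)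

theorem Bdd.mono {A C : Set X} (h : S.Bdd C) (hAC : A ⊆ C) : S.Bdd A := by
  obtain ⟨U, hU, W, hW, hCW⟩ := h
  exact ⟨U, hU, W, hW, hAC.trans hCW⟩

theorem CoarselyClopen.compl {A : Set X} (h : S.CoarselyClopen A) : S.CoarselyClopen Aᶜ := by
  intro U hU
  rw [compl_compl, Set.inter_comm]
  exact h U hU

/-- A point outside `A ∩ C` is outside `A` or outside `C`, so the boundary of the intersection lies
in the union of the two boundaries. -/
theorem CoarselyClopen.inter {A C : Set X} (hA : S.CoarselyClopen A) (hC : S.CoarselyClopen C) :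
    S.CoarselyClopen (A ∩ C) := by
  intro U hU
  refine Bdd.mono S (S.coarsely_connected _ _ (hA U hU) (hC U hU)) ?_
  rintro x ⟨⟨V, hV, ⟨y, ⟨hyA, hyC⟩, hyV⟩, hxV⟩, W, hW, ⟨z, hz, hzW⟩, hxW⟩
  by_cases hzA : z ∈ A
  · exact Or.inr ⟨⟨V, hV, ⟨y, hyC, hyV⟩, hxV⟩, W, hW, ⟨z, fun h => hz ⟨hzA, h⟩, hzW⟩, hxW⟩
  · exact Or.inl ⟨⟨V, hV, ⟨y, hyA, hyV⟩, hxV⟩, W, hW, ⟨z, hzA, hzW⟩, hxW⟩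

/-- Every unbounded coarsely clopen set belongs to an end. -/
theorem exists_mem_ends {A : Set X} (hA : S.CoarselyClopen A) (hAu : ¬ S.Bdd A) :
    ∃ E ∈ S.ends, A ∈ E := by
  have h0 : S.IsPreEnd {A} := by
    refine ⟨by rintro _ rfl; exact ⟨hAu, hA⟩, fun F hF _ hb => hAu ?_⟩
    exact Bdd.mono S hb fun x hx => Set.mem_sInter.2 fun t ht => by rwa [hF ht]
  obtain ⟨E, hAE, hE⟩ := zorn_subset_nonempty {E | S.IsPreEnd E} (by
    intro c hc hchain hne
    refine ⟨⋃₀ c, ⟨?_, ?_⟩, fun s hs => Set.subset_sUnion_of_mem hs⟩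
    · rintro B ⟨E, hE, hB⟩
      exact (hc hE).1 B hB
    · intro F hF hfin
      obtain ⟨E, hE, hFE⟩ :=
        DirectedOn.exists_mem_subset_of_finite_of_subset_sUnion hne hchain.directedOn hfin hF
      exact (hc hE).2 F hFE hfin) {A} h0
  exact ⟨E, hE, hAE rfl⟩

theorem ne_of_mem_of_mem_ends {A C : Set X} {E E' : Set (Set X)} (hE : E ∈ S.ends)
    (hA : A ∈ E) (hC : C ∈ E') (hAC : S.Bdd (A ∩ C)) : E ≠ E' := by
  rintro rfl
  refine hE.prop.2 {A, C} ?_ (Set.toFinite _) ?_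
  · rintro _ (rfl | rfl) <;> assumption
  · simpa [Set.sInter_insert] using hAC

/-- In a space with two ends, there are no three pairwise disjoint unbounded coarsely clopen
sets. -/
theorem bdd_or_bdd_of_ends {A C : Set X} (h2 : S.ends.encard = 2) (hA : S.CoarselyClopen A)
    (hC : S.CoarselyClopen C) (hAu : ¬ S.Bdd Aᶜ) (hb : S.Bdd ∅) :
    S.Bdd (A ∩ C) ∨ S.Bdd (A ∩ Cᶜ) := by
  by_contra! h
  obtain ⟨E₁, hE₁, h₁⟩ := S.exists_mem_ends (hA.inter S hC) h.1
  obtain ⟨E₂, hE₂, h₂⟩ := S.exists_mem_ends (hA.inter S (hC.compl S)) h.2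
  obtain ⟨E₃, hE₃, h₃⟩ := S.exists_mem_ends (hA.compl S) hAu
  have h12 : E₁ ≠ E₂ := S.ne_of_mem_of_mem_ends hE₁ h₁ h₂ (hb.mono S (by grind))
  have h13 : E₁ ≠ E₃ := S.ne_of_mem_of_mem_ends hE₁ h₁ h₃ (hb.mono S (by grind))
  have h23 : E₂ ≠ E₃ := S.ne_of_mem_of_mem_ends hE₂ h₂ h₃ (hb.mono S (by grind))
  obtain ⟨a, b, -, hab⟩ := Set.encard_eq_two.1 h2
  rw [hab] at hE₁ hE₂ hE₃
  grind

/-- A space with two ends is split by a coarsely clopen set. -/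
theorem exists_split_of_ends (h2 : S.ends.encard = 2) :
    ∃ A, S.CoarselyClopen A ∧ ¬ S.Bdd A ∧ ¬ S.Bdd Aᶜ := by
  obtain ⟨E, E', hne, hE⟩ := Set.encard_eq_two.1 h2
  have h1 : E ∈ S.ends := by simp [hE]
  have h2 : E' ∈ S.ends := by simp [hE]
  obtain ⟨A, hAE, hAE'⟩ : ∃ A ∈ E, A ∉ E' := by
    by_contra! h
    exact hne (h1.eq_of_le h2.prop h)
  -- If `Aᶜ` were bounded, intersecting with `A` would remove only a bounded set, so `A` could be
  -- added to `E'`, against maximality.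
  refine ⟨A, (h1.prop.1 A hAE).2, (h1.prop.1 A hAE).1, fun hb => hAE' ?_⟩
  refine h2.le_of_ge (y := insert A E') ⟨?_, ?_⟩ (Set.subset_insert _ _) (Set.mem_insert _ _)
  · rintro B (rfl | hB)
    · exact h1.prop.1 _ hAE
    · exact h2.prop.1 B hB
  · intro F hF hfin hbF
    refine h2.prop.2 (F \ {A}) (fun B hB => (hF hB.1).resolve_left hB.2) hfin.sdiff ?_
    refine Bdd.mono S (S.coarsely_connected _ _ hb hbF) fun x hx => ?_
    by_cases hxA : x ∈ A
    · refine Or.inr fun B hB => ?_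
      by_cases hBA : B = A
      · rwa [hBA]
      · exact hx B ⟨hB, hBA⟩
    · exact Or.inl hxA

end LargeScaleStructure

/-! ### Translates of a splitting set and bounded geometry in a large scale group -/

namespace LargeScaleGroup

variable {G : Type u} [Group G] [Bornology G] [LargeScaleGroup G]

theorem isBounded_smul (g : G) {A : Set G} (hA : IsBounded A) : IsBounded (g • A) := by
  have := isBounded_mul _ _ (isBounded_singleton (x := g)) hA
  rwa [Set.singleton_mul] at this

/-- This turns covers into right multiplication: stars over a refinement of the translates of `B`
lie in `C * (B⁻¹ * B)`, while `C * B` lies in the star of `C` over the translates of `B ∪ {1}`. -/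
theorem coarselyClopen_iff (A : Set G) :
    (largeScale G).CoarselyClopen A ↔
      ∀ B : Set G, IsBounded B → IsBounded (A * B ∩ (Aᶜ * B)) := by
  constructor
  · intro h B hB
    have hB' : IsBounded (B ∪ {1}) := hB.union isBounded_singleton
    have key := (bdd_iff G _).1 (h _ (translates_mem hB' ⟨1, by simp⟩))
    refine key.subset (Set.inter_subset_inter ?_ ?_) <;>
    · rintro _ ⟨a, ha, b, hb, rfl⟩
      exact ⟨_, ⟨a, rfl⟩, ⟨a, ha, 1, by simp, by simp⟩, b, Or.inl hb, rfl⟩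
  · rintro h U ⟨-, B, hB, hUB⟩
    rw [bdd_iff]
    have hs : ∀ C : Set G, starSet C U ⊆ C * (B⁻¹ * B) := by
      rintro C x ⟨W, hW, ⟨c, hc, hcW⟩, hxW⟩
      obtain ⟨_, ⟨g, rfl⟩, hg⟩ := hUB W hW
      obtain ⟨b, hb, rfl⟩ := hg hcW
      obtain ⟨d, hd, rfl⟩ := hg hxW
      exact ⟨_, hc, b⁻¹ * d, ⟨b⁻¹, by simpa using hb, d, hd, rfl⟩, by simp [mul_assoc]⟩
    exact (h _ (isBounded_mul _ _ (isBounded_inv _ hB) hB)).subset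
      (Set.inter_subset_inter (hs _) (hs _))

theorem coarselyClopen_smul (g : G) {A : Set G} (hA : (largeScale G).CoarselyClopen A) :
    (largeScale G).CoarselyClopen (g • A) := by
  rw [coarselyClopen_iff] at hA ⊢
  intro B hB
  rw [← Set.smul_set_compl, smul_mul_assoc, smul_mul_assoc, ← Set.smul_set_inter]
  exact isBounded_smul g (hA B hB)

theorem isBounded_of_smul (g : G) {A : Set G} (hA : IsBounded (g • A)) : IsBounded A := by
  simpa using isBounded_smul g⁻¹ hA

/-- In a group with two ends, the translates of a splitting set are equal to it or to its complement
up to bounded sets. -/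
theorem isBounded_symmDiff_smul {A : Set G} (h2 : (largeScale G).ends.encard = 2)
    (hA : (largeScale G).CoarselyClopen A) (hAu : ¬ IsBounded A) (hAu' : ¬ IsBounded Aᶜ) (g : G) :
    IsBounded (symmDiff A (g • A)) ∨ IsBounded (symmDiff Aᶜ (g • A)) := by
  have hC := coarselyClopen_smul g hA
  have hb : (largeScale G).Bdd ∅ := (bdd_iff G _).2 isBounded_empty
  have h1 := (largeScale G).bdd_or_bdd_of_ends h2 hA hC (by rwa [bdd_iff]) hb
  have h2 := (largeScale G).bdd_or_bdd_of_ends h2 (hA.compl _) hC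
    (by rwa [bdd_iff, compl_compl]) hb
  have hCu : ¬ IsBounded (g • A) := fun h => hAu (isBounded_of_smul g h)
  have hCu' : ¬ IsBounded (g • A)ᶜ := fun h =>
    hAu' (isBounded_of_smul g (by rwa [Set.smul_set_compl]))
  simp only [bdd_iff] at h1 h2
  generalize g • A = C at *
  -- The two mixed cases are the two alternatives of the conclusion; the others would make `g • A`
  -- or its complement bounded.
  rcases h1 with h1 | h1 <;> rcases h2 with h2 | h2
  · exact absurd ((h1.union h2).subset (by grind)) hCu
  · refine Or.inr ((h1.union h2).subset ?_)
    intro x; simp only [Set.mem_symmDiff]; grind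
  · refine Or.inl ((h1.union h2).subset ?_)
    intro x; simp only [Set.mem_symmDiff]; grind
  · exact absurd ((h1.union h2).subset (by grind)) hCu'

/-- Bounded geometry: all bounded sets are covered by finitely many translates of one of them. -/
theorem exists_finite_mul_of_boundedGeometry (h : (largeScale G).BoundedGeometry) :
    ∃ K : Set G, IsBounded K ∧ ∀ B : Set G, IsBounded B → ∃ F : Set G, F.Finite ∧ B ⊆ F * K := by
  obtain ⟨Y, T, ⟨f, g, -, hf, -, -, ⟨U, ⟨-, K, hK, hUK⟩, hU⟩, -⟩, hfin⟩ := h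
  -- Both `x` and `g (f x)` lie in one translate of `K`, so `x ∈ g (f x) • (K⁻¹ * K)`; for `x ∈ B`
  -- the values `f x` lie in a finite set.
  refine ⟨K⁻¹ * K, isBounded_mul _ _ (isBounded_inv _ hK) hK, fun B hB => ?_⟩
  obtain ⟨V, hV, W, hW, hBW⟩ := (bdd_iff G B).2 hB
  obtain ⟨V', hV', href⟩ := hf V hV
  obtain ⟨Z, hZ, hWZ⟩ := href _ ⟨W, hW, rfl⟩
  obtain ⟨N, hN⟩ := hfin V' hV'
  have hZfin : Z.Finite := Set.finite_of_encard_le_coe (hN Z hZ)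
  refine ⟨g '' Z, hZfin.image g, fun x hx => ?_⟩
  refine ⟨g (f x), ⟨f x, hWZ ⟨x, hBW hx, rfl⟩, rfl⟩, ?_⟩
  obtain ⟨P, hP, ⟨y, hy, hyP⟩, hxP⟩ := hU x
  obtain rfl : y = x := hy
  obtain ⟨_, ⟨k, rfl⟩, hk⟩ := hUK P hP
  obtain ⟨b, hb, hbe⟩ := hk hyP
  obtain ⟨d, hd, hde⟩ := hk hxP
  simp only [smul_eq_mul, Function.comp] at hbe hde
  refine ⟨d⁻¹ * b, ⟨d⁻¹, by simpa using hd, b, hb, rfl⟩, ?_⟩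
  change g (f y) * (d⁻¹ * b) = y
  rw [← hde, mul_assoc, mul_inv_cancel_left, hbe]

theorem isBounded_pow {B : Set G} (hB : IsBounded B) : ∀ n : ℕ, IsBounded (B ^ n)
  | 0 => by
    rw [pow_zero]
    exact isBounded_singleton
  | n + 1 => by
    rw [pow_succ]
    exact isBounded_mul _ _ (isBounded_pow hB n) hB

theorem isBounded_coarseBoundary {A B : Set G} (hA : (largeScale G).CoarselyClopen A)
    (hB : IsBounded B) : IsBounded (coarseBoundary A B) :=
  (coarselyClopen_iff A).1 hA B hB

/-! ### Unbounded cyclic subgroups and bounded index -/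

/-- If the powers of `g` are unbounded in both directions and go from the complement of `A` to `A`,
which is invariant under `g` up to a bounded set, then they have bounded index. -/
theorem isOfBoundedIndex_zpowers {A : Set G} (hA : (largeScale G).CoarselyClopen A) {g : G}
    (hgA : IsBounded (symmDiff A (g • A)))
    (hpos : ∀ n : ℕ, g ^ (n + 1) ∈ A) (hneg : ∀ n : ℕ, (g ^ (n + 1))⁻¹ ∉ A)
    (hg : ¬ IsBounded (Set.range fun n : ℕ => g ^ (n + 1))) :
    IsOfBoundedIndex (Subgroup.zpowers g) := by
  have hg' : ¬ IsBounded (Set.range fun n : ℕ => (g ^ (n + 1))⁻¹) := by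
    intro h
    refine hg ((isBounded_inv _ h).subset ?_)
    rintro _ ⟨n, rfl⟩
    exact ⟨n, by simp⟩
  have hx : ∀ x : G, ∃ k : ℤ, g ^ k * x ∈ symmDiff A (g • A) := by
    intro x
    by_contra! hk
    -- A point outside the symmetric difference is in `A` exactly when it is in `g • A`; for `g ^ (k
    -- + 1) * x` the latter means `g ^ k * x ∈ A`.
    have hstep : ∀ k : ℤ, (g ^ (k + 1) * x ∈ A ↔ g ^ k * x ∈ A) := by
      intro k
      have h := hk (k + 1)
      rw [Set.mem_symmDiff, Set.mem_smul_set_iff_inv_smul_mem, smul_eq_mul, add_comm,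
        zpow_add, zpow_one, mul_assoc, inv_mul_cancel_left] at h
      rw [add_comm, zpow_add, zpow_one, mul_assoc]
      tauto
    have hconst : ∀ k : ℤ, (g ^ k * x ∈ A ↔ x ∈ A) := by
      intro k
      induction k using Int.induction_on with
      | zero => simp
      | succ i ih => rw [hstep, ih]
      | pred i ih => rw [← ih, ← hstep, sub_add_cancel]
    -- The orbit of `x` stays on one side of `A`, while one half of the powers of `g` is on the
    -- other side. Since `g ^ k = (g ^ k * x) * x⁻¹`, that unbounded half lies in the boundary at
    -- scale `{1, x⁻¹}`.
    have hb : IsBounded ({1, x⁻¹} : Set G) := (Set.toFinite _).isBounded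
    have hbd := isBounded_coarseBoundary hA hb
    by_cases hxA : x ∈ A
    · refine hg' (hbd.subset ?_)
      rintro _ ⟨n, rfl⟩
      refine ⟨⟨_, (hconst (-((n + 1 : ℕ) : ℤ))).2 hxA, x⁻¹, by simp, ?_⟩,
        ⟨_, hneg n, 1, by simp, by simp⟩⟩
      rw [zpow_neg, zpow_natCast]
      simp
    · refine hg (hbd.subset ?_)
      rintro _ ⟨n, rfl⟩
      refine ⟨⟨_, hpos n, 1, by simp, by simp⟩,
        ⟨_, fun h => hxA ((hconst ((n + 1 : ℕ) : ℤ)).1 h), x⁻¹, by simp, ?_⟩⟩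
      rw [zpow_natCast]
      simp
  refine ⟨(symmDiff A (g • A))⁻¹, isBounded_inv _ hgA, Set.eq_univ_of_forall fun x => ?_⟩
  obtain ⟨k, hk⟩ := hx x⁻¹
  refine ⟨(g ^ k * x⁻¹)⁻¹, Set.inv_mem_inv.2 hk, g ^ k, ⟨k, rfl⟩, ?_⟩
  simp

omit [LargeScaleGroup G] in
/-- The powers of `g` are unbounded if none of them lies in `K⁻¹ * K`, where `K` is as in
`exists_finite_mul_of_boundedGeometry`. -/
theorem not_isBounded_range_pow {K : Set G}
    (hK : ∀ B : Set G, IsBounded B → ∃ F : Set G, F.Finite ∧ B ⊆ F * K) {g : G}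
    (hg : ∀ n : ℕ, g ^ (n + 1) ∉ K⁻¹ * K) :
    ¬ IsBounded (Set.range fun n : ℕ => g ^ (n + 1)) := by
  intro hb
  obtain ⟨F, hF, hsub⟩ := hK _ hb
  have := hF.to_subtype
  have hch : ∀ n : ℕ, ∃ f : F, ∃ k ∈ K, (f : G) * k = g ^ (n + 1) := by
    intro n
    obtain ⟨f, hf, k, hk, h⟩ := hsub ⟨n, rfl⟩
    exact ⟨⟨f, hf⟩, k, hk, h⟩
  choose f k hk hfk using hch
  -- Two powers in the same translate `f • K` differ by a positive power of `g` in `K⁻¹ * K`.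
  obtain ⟨i, j, hne, hij⟩ := Finite.exists_ne_map_eq_of_infinite f
  wlog hlt : i < j generalizing i j
  · exact this j i hne.symm hij.symm (by omega)
  obtain ⟨m, rfl⟩ := Nat.exists_eq_add_of_lt hlt
  refine hg m ⟨(k i)⁻¹, Set.inv_mem_inv.2 (hk i), k (i + m + 1), hk _, ?_⟩
  have h1 := hfk i
  have h2 := hfk (i + m + 1)
  rw [← hij, show i + m + 1 + 1 = (i + 1) + (m + 1) by omega, pow_add, ← h1, mul_assoc] at h2
  change (k i)⁻¹ * k (i + m + 1) = _
  rw [mul_left_cancel h2, inv_mul_cancel_left]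

/-! ### Splitting the subgroup generated by a bounded set -/

/-- If the part of `Aᶜ` in each subgroup generated by `B` and one more element is bounded, then
`Aᶜ` is bounded. -/
theorem isBounded_compl_of_closure {K A B : Set G}
    (hK : ∀ B : Set G, IsBounded B → ∃ F : Set G, F.Finite ∧ B ⊆ F * K)
    (hA : (largeScale G).CoarselyClopen A) (hB : IsBounded B) (h1 : 1 ∈ B) (hsym : B⁻¹ = B)
    (hKB : K ⊆ B) (hun : ¬ IsBounded (Subgroup.closure B : Set G))
    (hsplit : ∀ x : G, ∃ C : Set G, B ⊆ C ∧ x ∈ C ∧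
      (IsBounded ((Subgroup.closure C : Set G) ∩ A) ∨
        IsBounded ((Subgroup.closure C : Set G) ∩ Aᶜ)))
    (hAc : IsBounded ((Subgroup.closure B : Set G) ∩ Aᶜ)) : IsBounded Aᶜ := by
  have hcoset : ∀ x : G, IsBounded ((x • (Subgroup.closure B : Set G)) ∩ Aᶜ) := by
    intro x
    obtain ⟨C, hBC, hxC, hC⟩ := hsplit x
    have hle : Subgroup.closure B ≤ Subgroup.closure C := Subgroup.closure_mono hBC
    -- A bounded `A`-part of the larger subgroup would bound both parts of the subgroup generated by
    -- `B`. Otherwise its `Aᶜ`-part is bounded and contains that of the coset of `x`.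
    rcases hC with hC | hC
    · refine absurd ((hAc.union hC).subset fun h hh => ?_) hun
      by_cases hhA : h ∈ A
      · exact Or.inr ⟨hle hh, hhA⟩
      · exact Or.inl ⟨hh, hhA⟩
    · refine hC.subset (Set.inter_subset_inter_left _ ?_)
      rintro _ ⟨h, hh, rfl⟩
      exact mul_mem (Subgroup.subset_closure hxC) (hle hh)
  -- Finitely many cosets suffice: a coset that meets `Aᶜ` also meets `A`, being unbounded, hence
  -- meets the boundary. The boundary is covered by `F * K`, and `K` lies in the subgroup, so the
  -- coset is that of some `f ∈ F`.
  obtain ⟨F, hF, hsub⟩ := hK _ (isBounded_coarseBoundary hA hB)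
  refine ((isBounded_biUnion hF).2 fun f _ => hcoset f).subset fun x hx => ?_
  obtain ⟨h, hh, hxh⟩ : ∃ h ∈ Subgroup.closure B, x * h ∈ A := by
    by_contra! hall
    refine hun (isBounded_of_smul x ((hcoset x).subset ?_))
    rintro _ ⟨h, hh, rfl⟩
    exact ⟨⟨h, hh, rfl⟩, hall h hh⟩
  obtain ⟨k, hk, hkb⟩ := exists_mem_coarseBoundary (A := Aᶜ) h1 hsym hh hx (by simpa using hxh)
  rw [coarseBoundary_compl] at hkb
  obtain ⟨f, hf, c, hc, hfc⟩ := hsub hkb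
  refine Set.mem_biUnion hf ⟨⟨c * k⁻¹, mul_mem (Subgroup.subset_closure (hKB hc)) (inv_mem hk), ?_⟩,
    hx⟩
  change f * (c * k⁻¹) = x
  rw [← mul_assoc, show f * c = x * k from hfc, mul_inv_cancel_right]

/-- A splitting set splits the subgroup generated by some bounded set. -/
theorem exists_split_closure {K A : Set G} (hKb : IsBounded K)
    (hK : ∀ B : Set G, IsBounded B → ∃ F : Set G, F.Finite ∧ B ⊆ F * K)
    (hloc : ¬ IsLocallyBounded G) (hA : (largeScale G).CoarselyClopen A)
    (hAu : ¬ IsBounded A) (hAu' : ¬ IsBounded Aᶜ) :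
    ∃ B : Set G, IsBounded B ∧ 1 ∈ B ∧ B⁻¹ = B ∧ K ⊆ B ∧
      ¬ IsBounded ((Subgroup.closure B : Set G) ∩ A) ∧
      ¬ IsBounded ((Subgroup.closure B : Set G) ∩ Aᶜ) := by
  by_contra! hall
  obtain ⟨B₀, hB₀, hun⟩ : ∃ B : Set G, IsBounded B ∧ ¬ IsBounded (Subgroup.closure B : Set G) := by
    by_contra! h
    exact hloc h
  -- Every admissible generating set is assumed not to be split. Comparing `S ∅` with `S {x}` for
  -- each `x` shows that the side bounded in the subgroup of `S ∅` is bounded in all of `G`.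
  let S : Set G → Set G := fun C => (B₀ ∪ K ∪ {1} ∪ C) ∪ (B₀ ∪ K ∪ {1} ∪ C)⁻¹
  have hSb : ∀ C, IsBounded C → IsBounded (S C) := fun C hC =>
    have h := ((hB₀.union hKb).union isBounded_singleton).union hC
    h.union (isBounded_inv _ h)
  have hS1 : ∀ C, 1 ∈ S C := fun C => by simp [S]
  have hSsym : ∀ C, (S C)⁻¹ = S C := fun C => by
    simp only [S]
    rw [Set.union_inv, inv_inv, Set.union_comm]
  have hSK : ∀ C, K ⊆ S C := fun C x hx => by simp [S, hx]
  have hmono : ∀ C, S ∅ ⊆ S C := fun C =>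
    Set.union_subset_union (Set.union_subset_union_right _ (Set.empty_subset _))
      (Set.inv_subset_inv.2 (Set.union_subset_union_right _ (Set.empty_subset _)))
  have hunS : ¬ IsBounded (Subgroup.closure (S ∅) : Set G) := fun h =>
    hun (h.subset (Subgroup.closure_mono fun x hx => by simp [S, hx]))
  have hsplit : ∀ x : G, ∃ C : Set G, S ∅ ⊆ C ∧ x ∈ C ∧
      (IsBounded ((Subgroup.closure C : Set G) ∩ A) ∨
        IsBounded ((Subgroup.closure C : Set G) ∩ Aᶜ)) := fun x =>
    ⟨S {x}, hmono _, by simp [S], or_iff_not_imp_left.2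
      (hall _ (hSb _ isBounded_singleton) (hS1 _) (hSsym _) (hSK _))⟩
  have hb := hSb ∅ isBounded_empty
  by_cases h : IsBounded ((Subgroup.closure (S ∅) : Set G) ∩ A)
  · refine hAu ?_
    have := isBounded_compl_of_closure hK (hA.compl _) hb (hS1 _) (hSsym _) (hSK _) hunS
      (by simpa only [compl_compl, or_comm] using hsplit) (by rwa [compl_compl])
    rwa [compl_compl] at this
  · exact hAu' (isBounded_compl_of_closure hK hA hb (hS1 _) (hSsym _) (hSK _) hunS hsplit
      (hall _ hb (hS1 _) (hSsym _) (hSK _) h))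

/-! ### Finding the translating element and the ball that contains the boundary -/

/-- If each translate of `A` is equal to `A` or to its complement up to bounded sets, then an
unbounded intersection of `A` with a subgroup has unboundedly many elements that keep `A` up to
bounded sets. -/
theorem not_isBounded_stabilizer {A : Set G} (hA : (largeScale G).CoarselyClopen A)
    (hsd : ∀ g : G, IsBounded (symmDiff A (g • A)) ∨ IsBounded (symmDiff Aᶜ (g • A)))
    {H : Subgroup G} (hH : ¬ IsBounded ((H : Set G) ∩ A)) :
    ¬ IsBounded {h : G | h ∈ H ∧ h ∈ A ∧ IsBounded (symmDiff A (h • A))} := by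
  intro hb
  set S := {h : G | h ∈ H ∧ h ∈ A ∧ IsBounded (symmDiff A (h • A))} with hS
  obtain ⟨t, ⟨htH, htA⟩, htS⟩ : ∃ t ∈ (H : Set G) ∩ A, t ∉ S := by
    by_contra! h
    exact hH (hb.subset h)
  have htc : IsBounded (symmDiff Aᶜ (t • A)) := (hsd t).resolve_left fun h => htS ⟨htH, htA, h⟩
  have hbd := isBounded_coarseBoundary hA (B := {1, t}) (Set.toFinite _).isBounded
  refine hH ((hb.union ((isBounded_mul _ _ hb isBounded_singleton).union hbd)).subset
    (t := S ∪ (S * {t} ∪ coarseBoundary A {1, t})) ?_)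
  rintro h ⟨hhH, hhA⟩
  by_cases hhS : h ∈ S
  · exact Or.inl hhS
  refine Or.inr ?_
  -- Both `h` and `t` exchange `A` and `Aᶜ` up to bounded sets, so `h * t⁻¹` keeps `A`. Thus `h ∈ S
  -- * {t}` when `h * t⁻¹ ∈ A`, and otherwise `h` is in the boundary at scale `{1, t}`.
  by_cases hht : h * t⁻¹ ∈ A
  · refine Or.inl ⟨h * t⁻¹, ⟨mul_mem hhH (inv_mem htH), hht, ?_⟩, t, rfl, by simp⟩
    have hhc : IsBounded (symmDiff Aᶜ (h • A)) := (hsd h).resolve_left fun h' => hhS ⟨hhH, hhA, h'⟩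
    have htr := isBounded_smul (h * t⁻¹) htc
    refine (hhc.union htr).subset fun x hx => ?_
    simp only [Set.mem_union, Set.mem_symmDiff, Set.mem_smul_set_iff_inv_smul_mem, Set.mem_compl_iff,
      smul_eq_mul, mul_inv_rev, inv_inv, mul_assoc, inv_mul_cancel_left] at hx ⊢
    tauto
  · exact Or.inr ⟨⟨h, hhA, 1, by simp, by simp⟩, ⟨h * t⁻¹, hht, t, by simp, by simp⟩⟩

omit [LargeScaleGroup G] in
/-- The part of a bounded set in the subgroup generated by `B` lies in a power of `B`. -/
theorem exists_subset_pow {K B P : Set G}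
    (hK : ∀ B : Set G, IsBounded B → ∃ F : Set G, F.Finite ∧ B ⊆ F * K)
    (h1 : 1 ∈ B) (hsym : B⁻¹ = B) (hKB : K ⊆ B) (hP : IsBounded P) :
    ∃ n : ℕ, 2 ≤ n ∧ ∀ x ∈ Subgroup.closure B, x ∈ P → x ∈ B ^ n := by
  obtain ⟨F, hF, hsub⟩ := hK P hP
  have hch : ∀ f : G, ∃ n : ℕ, f ∈ Subgroup.closure B → f ∈ B ^ n := by
    intro f
    by_cases hf : f ∈ Subgroup.closure B
    · obtain ⟨n, hn⟩ := exists_mem_pow_of_mem_closure hsym hf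
      exact ⟨n, fun _ => hn⟩
    · exact ⟨0, fun h => absurd h hf⟩
  choose e he using hch
  obtain ⟨N, hN⟩ := (hF.image e).bddAbove
  -- One extra factor of `B` absorbs `K`; the other ensures `2 ≤ n`, which later places `K⁻¹ * K` in
  -- `B ^ n`.
  refine ⟨N + 2, by omega, fun x hx hxP => ?_⟩
  obtain ⟨f, hf, k, hk, rfl⟩ := hsub hxP
  have hfH : f ∈ Subgroup.closure B :=
    (Subgroup.mul_mem_cancel_right _ (Subgroup.subset_closure (hKB hk))).1 hx
  refine Set.pow_subset_pow_right h1 (m := e f + 1) ?_ ?_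
  · have := hN ⟨f, hf, rfl⟩
    omega
  · rw [pow_succ]
    exact Set.mul_mem_mul (he f hfH) (hKB hk)

end LargeScaleGroup

/-! ### The infinite cyclic subgroup of bounded index -/

theorem theorem9p13 (G : Type u) [Group G] [Bornology G] [LargeScaleGroup G]
    (hgeom : (LargeScaleGroup.largeScale G).BoundedGeometry)
    (hloc : ¬ LargeScaleGroup.IsLocallyBounded G)
    (hsigma : LargeScaleGroup.IsSigmaBounded G)
    (hends : (LargeScaleGroup.largeScale G).ends.encard = 2) :
    ∃ H : Subgroup G, IsCyclic H ∧ Infinite H ∧ LargeScaleGroup.IsOfBoundedIndex H := by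
  obtain ⟨K, hKb, hK⟩ := exists_finite_mul_of_boundedGeometry hgeom
  obtain ⟨A, hA, hAu, hAu'⟩ := (largeScale G).exists_split_of_ends hends
  rw [bdd_iff] at hAu hAu'
  obtain ⟨B, hB, h1, hsym, hKB, hHA, hHA'⟩ := exists_split_closure hKb hK hloc hA hAu hAu'
  obtain ⟨n, hn2, hn⟩ := exists_subset_pow hK h1 hsym hKB (isBounded_coarseBoundary hA hB)
  obtain ⟨g, ⟨hgH, hgA, hgsd⟩, hgQ⟩ : ∃ g ∈ {h : G | h ∈ Subgroup.closure B ∧ h ∈ A ∧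
      IsBounded (symmDiff A (h • A))}, g ∉ B ^ n * (B ^ n)⁻¹ := by
    by_contra! h
    exact not_isBounded_stabilizer hA (isBounded_symmDiff_smul hends hA hAu hAu') hHA
      ((isBounded_mul _ _ (isBounded_pow hB n) (isBounded_inv _ (isBounded_pow hB n))).subset h)
  have hone : (1 : G) ∈ B ^ n := Set.one_mem_pow h1
  have hdisj : ∀ q ∈ B ^ n, g * q ∉ B ^ n := fun q hq hq' =>
    hgQ ⟨g * q, hq', q⁻¹, Set.inv_mem_inv.2 hq, by simp⟩
  -- Otherwise the part of `Aᶜ` in the subgroup would lie in `g • A`, hence in the bounded set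
  -- `symmDiff A (g • A)`.
  have hun : ∃ y ∈ Subgroup.closure B, y ∉ A ∧ g⁻¹ * y ∉ A := by
    by_contra! h
    refine hHA' (hgsd.subset fun y ⟨hy, hyA⟩ => Or.inr ⟨?_, hyA⟩)
    exact Set.mem_smul_set_iff_inv_smul_mem.2 (h y hy hyA)
  obtain ⟨hQA, hQA', hmono⟩ := translate_mem h1 hsym hgH hgA hn hdisj hun
  have hpos : ∀ k : ℕ, g ^ (k + 1) ∈ A := by
    intro k
    induction k with
    | zero => simpa using hgA
    | succ k ih =>
      by_contra hk
      have := hmono _ (pow_mem hgH _) hk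
      rw [pow_succ' g (k + 1), inv_mul_cancel_left] at this
      exact this ih
  have hneg : ∀ k : ℕ, (g ^ (k + 1))⁻¹ ∉ A := by
    intro k
    induction k with
    | zero => simpa using hQA' 1 hone
    | succ k ih =>
      have := hmono _ (inv_mem (pow_mem hgH _)) ih
      rwa [← mul_inv_rev, ← pow_succ] at this
  have hQ : ∀ k : ℕ, g ^ (k + 1) ∉ B ^ n := by
    intro k hk
    cases k with
    | zero => exact hdisj 1 hone (by simpa using hk)
    -- If `g ^ (k + 2)` were in the ball, then `g⁻¹` would carry it outside `A`, but it carries it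
    -- to `g ^ (k + 1) ∈ A`.
    | succ k =>
      have := hQA' _ hk
      rw [pow_succ' g (k + 1), inv_mul_cancel_left] at this
      exact this (hpos k)
  have hKK : K⁻¹ * K ⊆ B ^ n := by
    refine (Set.mul_subset_mul (Set.inv_subset_inv.2 hKB) hKB).trans ?_
    rw [hsym, ← pow_two]
    exact Set.pow_subset_pow_right h1 hn2
  refine ⟨Subgroup.zpowers g, inferInstance, ?_, isOfBoundedIndex_zpowers hA hgsd hpos hneg
    (not_isBounded_range_pow hK fun k hk => hQ k (hKK hk))⟩
  -- A positive power equal to `1` would lie in the ball `B ^ n`.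
  refine (infinite_zpowers.2 fun hfin : IsOfFinOrder g => ?_).to_subtype
  obtain ⟨k, hk, hk1⟩ := isOfFinOrder_iff_pow_eq_one.1 hfin
  obtain ⟨k, rfl⟩ := Nat.exists_eq_add_of_lt hk
  refine hQ k ?_
  rw [zero_add] at hk1
  rwa [hk1]
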